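/- Let $N$ be an odd positive integer and let $\alpha,\beta>0$ be real numbers with $\alpha\beta^{N}=\pi^{N+1}$. Let $\gamma$ denote Euler's constant and let $B_k$ be the Bernoulli numbers, defined by $\frac{x}{e^x-1}=\sum_{k\ge 0}\frac{B_k x^k}{k!}$ for $|x|<2\pi$. Then the infinite series below converge absolutely, and $$ \sum_{n=1}^{\infty}\frac{1}{n\left(\exp\left((2n)^{N}\alpha\right)-1\right)}-\frac{(-1)^{\frac{N+3}{2}}}{N}\sum_{j=-\frac{N-1}{2}}^{\frac{N-1}{2}}(-1)^{j}\sum_{n=1}^{\infty}\frac{1}{n\left(\exp\left((2n)^{\frac1N}\beta e^{\frac{i\pi j}{N}}\right)-1\right)} $$ $$ =\frac{(N-1)(\log 2-\gamma)}{2N}+\frac{\log(\alpha/\beta)}{2(N+1)}+(-1)^{\frac{N+3}{2}}\sum_{j=0}^{\left\lfloor\frac{N+1}{2N}\right\rfloor}\frac{(-1)^jB_{2j}B_{N+1-2Nj}}{(2j)!\,(N+1-2Nj)!}\,\alpha^{\frac{2j}{N+1}}\beta^{N-\frac{2N^2j}{N+1}}, $$ where all powers of positive real numbers are the positive real ones.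 -/

import Mathlib

/-- The term `1 / (n (exp((2n)^N α) - 1))` of the Lambert series with real argument. -/
noncomputable def lambertTerm (N : ℕ) (α : ℝ) (n : ℕ) : ℝ :=
  1 / ((n : ℝ) * (Real.exp ((2 * (n : ℝ)) ^ N * α) - 1))

/-- The term `1 / (n (exp((2n)^(1/N) β e^(iπj/N)) - 1))` of the rotated Lambert series;
`(2n)^(1/N)` is the positive real root. -/
noncomputable def rotatedLambertTerm (N : ℕ) (β : ℝ) (j : ℤ) (n : ℕ) : ℂ :=
  1 / ((n : ℂ) *
    (Complex.exp ((((2 * (n : ℝ)) ^ (1 / (N : ℝ)) * β : ℝ) : ℂ) *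
      Complex.exp (Complex.I * (Real.pi : ℂ) * (j : ℂ) / (N : ℂ))) - 1))

/-! Write N = 2M + 1 and κ = 2^N α / (2π). Both sides of the identity sum one positive double
series, with terms K(m,n) = κ n^(2M) / (κ² n^(2N) + m²), in two orders. The partial fractions of
1/(e^y - 1) turn the n-th real Lambert term into a multiple of 1/n^(N+1), minus 1/(2n), plus (1/π)
∑_m K(m,n) (`lambertTerm_eq`). Orthogonality of roots of unity turns the alternating sum over j of
the m-th rotated terms into -1/(2Nm) plus (1/π) ∑_n K(m,n), with an extra multiple of 1/m² only when
N = 1 (`sum_rotatedLambertTerm_eq`). The relation αβ^N = π^(N+1) is what makes the two kernels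
equal.

The double series diverges, so exchanging the order leaves a defect. Cut off at n ≤ X and m ≤ X^N:
the common rectangle cancels, and the two remaining tails are asymptotically Riemann sums for
Ti(κ)/N and Ti(1/κ)/N, where Ti(x) = ∫₀ˣ arctan w / w dw. Since Ti(κ) - Ti(1/κ) = (π/2) log κ, the
defect is explicit (`tendsto_lambertKernel_exchange`). With the same cutoffs the logarithms of the
harmonic sums cancel and leave a multiple of γ, while ζ(N+1), and ζ(2) if N = 1, give the Bernoulli
terms. -/

open Filter Topology

/-! ### The kernel and comparison of its tails with integrals. -/

/-- The kernel `κ x^p / (κ² x^(2(p+1)) + c²)`. -/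
noncomputable def lambertKernel (κ : ℝ) (p : ℕ) (c x : ℝ) : ℝ :=
  κ * x ^ p / (κ ^ 2 * x ^ (2 * (p + 1)) + c ^ 2)

/-- A primitive of `lambertKernel`. -/
noncomputable def lambertPrimitive (κ : ℝ) (p : ℕ) (c x : ℝ) : ℝ :=
  Real.arctan (κ * x ^ (p + 1) / c) / ((p + 1) * c)

lemma lambertKernel_nonneg {κ : ℝ} (hκ : 0 < κ) (p : ℕ) (c : ℝ) {x : ℝ} (hx : 0 ≤ x) :
    0 ≤ lambertKernel κ p c x := by
  unfold lambertKernel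
  positivity

lemma hasDerivAt_lambertPrimitive (κ : ℝ) (p : ℕ) {c : ℝ} (hc : 0 < c) (x : ℝ) :
    HasDerivAt (lambertPrimitive κ p c) (lambertKernel κ p c x) x := by
  have h1 : HasDerivAt (fun x : ℝ => κ * x ^ (p + 1) / c) (κ * ((p + 1 : ℕ) * x ^ p) / c) x := by
    simpa using ((hasDerivAt_pow (p + 1) x).const_mul κ).div_const c
  have h2 := (h1.arctan).div_const ((p + 1) * c)
  refine h2.congr_deriv ?_
  have h3 : 0 < κ ^ 2 * x ^ (2 * (p + 1)) + c ^ 2 := by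
    have : 0 ≤ x ^ (2 * (p + 1)) := by rw [pow_mul]; positivity
    positivity
  have h4 : 0 < 1 + (κ * x ^ (p + 1) / c) ^ 2 := by positivity
  have hp : (p + 1 : ℝ) ≠ 0 := by positivity
  unfold lambertKernel
  have h5 : 1 + (κ * x ^ (p + 1) / c) ^ 2 = (κ ^ 2 * x ^ (2 * (p + 1)) + c ^ 2) / c ^ 2 := by
    field_simp; ring
  rw [h5]
  push_cast
  field_simp

/-- The kernel need not be monotone, but its numerator and denominator are. Over a ratio of at most
ρ the numerator grows by at most ρ^p; this is weakened to the exponent of the reverse bound so that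
one constant serves both. -/
lemma lambertKernel_le_of_le {κ : ℝ} (hκ : 0 < κ) (p : ℕ) {c : ℝ} (hc : 0 < c) {x y ρ : ℝ}
    (hx : 0 < x) (hxy : x ≤ y) (hρ : 1 ≤ ρ) (hyρ : y ≤ ρ * x) :
    lambertKernel κ p c y ≤ ρ ^ (2 * (p + 1)) * lambertKernel κ p c x := by
  have hy : 0 < y := hx.trans_le hxy
  calc lambertKernel κ p c y
      ≤ κ * (ρ * x) ^ p / (κ ^ 2 * x ^ (2 * (p + 1)) + c ^ 2) := by
        unfold lambertKernel; gcongr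
    _ = ρ ^ p * lambertKernel κ p c x := by unfold lambertKernel; rw [mul_pow]; ring
    _ ≤ _ := by
        gcongr
        · exact lambertKernel_nonneg hκ p c hx.le
        · omega

lemma lambertKernel_ge_of_le {κ : ℝ} (hκ : 0 < κ) (p : ℕ) {c : ℝ} (hc : 0 < c) {x y ρ : ℝ}
    (hx : 0 < x) (hxy : x ≤ y) (hρ : 1 ≤ ρ) (hyρ : y ≤ ρ * x) :
    lambertKernel κ p c x ≤ ρ ^ (2 * (p + 1)) * lambertKernel κ p c y := by
  have hy : 0 < y := hx.trans_le hxy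
  have hρ0 : 0 < ρ := by linarith
  unfold lambertKernel
  rw [← mul_div_assoc, div_le_div_iff₀ (by positivity) (by positivity)]
  have h1 : κ ^ 2 * y ^ (2 * (p + 1)) + c ^ 2
      ≤ ρ ^ (2 * (p + 1)) * (κ ^ 2 * x ^ (2 * (p + 1)) + c ^ 2) := by
    have h2 : y ^ (2 * (p + 1)) ≤ ρ ^ (2 * (p + 1)) * x ^ (2 * (p + 1)) := by
      rw [← mul_pow]; gcongr
    have h3 : 1 ≤ ρ ^ (2 * (p + 1)) := one_le_pow₀ hρ
    nlinarith [mul_le_mul_of_nonneg_left h2 (sq_nonneg κ), sq_nonneg c]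
  have h4 : x ^ p ≤ y ^ p := by gcongr
  calc κ * x ^ p * (κ ^ 2 * y ^ (2 * (p + 1)) + c ^ 2)
      ≤ κ * y ^ p * (ρ ^ (2 * (p + 1)) * (κ ^ 2 * x ^ (2 * (p + 1)) + c ^ 2)) := by gcongr
    _ = _ := by ring

lemma tendsto_lambertPrimitive {κ : ℝ} (hκ : 0 < κ) (p : ℕ) {c : ℝ} (hc : 0 < c) :
    Tendsto (fun k : ℕ => lambertPrimitive κ p c k) atTop (𝓝 (Real.pi / 2 / ((p + 1) * c))) := by
  unfold lambertPrimitive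
  refine Tendsto.div_const ?_ _
  refine (tendsto_nhds_of_tendsto_nhdsWithin Real.tendsto_arctan_atTop).comp ?_
  refine Tendsto.atTop_div_const hc (Tendsto.const_mul_atTop hκ ?_)
  exact (tendsto_pow_atTop (Nat.succ_ne_zero p)).comp tendsto_natCast_atTop_atTop

/-- Comparison of the tail of the kernel sum with the tail of its integral. -/
lemma lambertKernel_tail {κ : ℝ} (hκ : 0 < κ) (p : ℕ) {c : ℝ} (hc : 0 < c) {X : ℕ} (hX : 1 ≤ X) :
    Summable (fun k : ℕ => lambertKernel κ p c ((X + k + 1 : ℕ) : ℝ)) ∧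
    Real.arctan (c / (κ * (X : ℝ) ^ (p + 1))) / ((p + 1) * c) ≤
      (1 + 1 / (X : ℝ)) ^ (2 * (p + 1)) * ∑' k : ℕ, lambertKernel κ p c ((X + k + 1 : ℕ) : ℝ) ∧
    ∑' k : ℕ, lambertKernel κ p c ((X + k + 1 : ℕ) : ℝ) ≤ (1 + 1 / (X : ℝ)) ^ (2 * (p + 1)) *
      (Real.arctan (c / (κ * (X : ℝ) ^ (p + 1))) / ((p + 1) * c)) := by
  -- Mean value points ξ satisfy ξ ≥ X, so the next integer is at most ξ + 1 ≤ ρ ξ. The resulting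
  -- factor is uniform in k and tends to 1 as X grows.
  set ρ : ℝ := 1 + 1 / (X : ℝ) with hρdef
  have hX0 : (0 : ℝ) < X := by exact_mod_cast hX
  have hρ : 1 ≤ ρ := by rw [hρdef]; have : 0 < 1 / (X : ℝ) := by positivity
                        linarith
  set Φ := fun k : ℕ => lambertPrimitive κ p c ((X + k : ℕ) : ℝ) with hΦ
  set h := fun k : ℕ => lambertKernel κ p c ((X + k + 1 : ℕ) : ℝ) with hh
  set R := ρ ^ (2 * (p + 1)) with hR
  have hR0 : 0 < R := by positivity
  have step : ∀ k, h k ≤ R * (Φ (k + 1) - Φ k) ∧ Φ (k + 1) - Φ k ≤ R * h k := by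
    intro k
    have hlt : ((X + k : ℕ) : ℝ) < ((X + k + 1 : ℕ) : ℝ) := by push_cast; linarith
    obtain ⟨ξ, hξ, e⟩ := exists_hasDerivAt_eq_slope (lambertPrimitive κ p c)
      (lambertKernel κ p c) hlt
      (fun x _ => (hasDerivAt_lambertPrimitive κ p hc x).continuousAt.continuousWithinAt)
      (fun x _ => hasDerivAt_lambertPrimitive κ p hc x)
    have e' : Φ (k + 1) - Φ k = lambertKernel κ p c ξ := by
      rw [e, hΦ]; push_cast; ring_nf
    have hξX : (X : ℝ) ≤ ξ := by
      have := hξ.1; push_cast at this; have h0 : (0 : ℝ) ≤ k := by positivity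
      linarith
    have hξ0 : 0 < ξ := hX0.trans_le hξX
    have hξρ : ((X + k + 1 : ℕ) : ℝ) ≤ ρ * ξ := by
      have h1 : ((X + k + 1 : ℕ) : ℝ) ≤ ξ + 1 := by have := hξ.1; push_cast at this ⊢; linarith
      have h2 : 1 ≤ 1 / (X : ℝ) * ξ := by
        rw [one_div, inv_mul_eq_div, le_div_iff₀ hX0]; linarith
      rw [hρdef]; linarith
    rw [e']
    exact ⟨lambertKernel_le_of_le hκ p hc hξ0 hξ.2.le hρ hξρ,
      lambertKernel_ge_of_le hκ p hc hξ0 hξ.2.le hρ hξρ⟩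
  have hlim : Tendsto Φ atTop (𝓝 (Real.pi / 2 / ((p + 1) * c))) := by
    have := (tendsto_lambertPrimitive hκ p hc).comp (tendsto_add_atTop_nat X)
    refine this.congr fun k => ?_
    simp [hΦ, add_comm]
  have hnn : ∀ k, 0 ≤ h k := fun k => lambertKernel_nonneg hκ p c (by positivity)
  have hdnn : ∀ k, 0 ≤ Φ (k + 1) - Φ k := fun k => by
    have := (hnn k).trans (step k).1
    exact nonneg_of_mul_nonneg_right this hR0
  have hA : Real.pi / 2 / ((p + 1) * c) - Φ 0
      = Real.arctan (c / (κ * (X : ℝ) ^ (p + 1))) / ((p + 1) * c) := by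
    have : c / (κ * (X : ℝ) ^ (p + 1)) = (κ * (X : ℝ) ^ (p + 1) / c)⁻¹ := by rw [inv_div]
    rw [this, Real.arctan_inv_of_pos (by positivity), hΦ]
    simp only [lambertPrimitive, add_zero]
    ring
  have hsum : HasSum (fun k => Φ (k + 1) - Φ k)
      (Real.arctan (c / (κ * (X : ℝ) ^ (p + 1))) / ((p + 1) * c)) := by
    rw [hasSum_iff_tendsto_nat_of_nonneg hdnn, ← hA]
    simp_rw [Finset.sum_range_sub]
    exact hlim.sub_const _
  have hs : Summable h :=
    Summable.of_nonneg_of_le hnn (fun k => (step k).1) (hsum.summable.mul_left R)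
  refine ⟨hs, ?_, ?_⟩
  · rw [← hsum.tsum_eq, ← tsum_mul_left]
    exact hsum.summable.tsum_le_tsum (fun k => (step k).2) (hs.mul_left R)
  · rw [← hsum.tsum_eq, ← tsum_mul_left]
    exact hs.tsum_le_tsum (fun k => (step k).1) (hsum.summable.mul_left R)

/-! ### Riemann sums and the inverse tangent integral. -/

/-- Right Riemann sums of a continuous function on `[0, 1]` converge to its integral. -/
lemma tendsto_riemann_sum {F : ℝ → ℝ} (hF : Continuous F) :
    Tendsto (fun X : ℕ => ∑ k ∈ Finset.range X, F ((k + 1 : ℕ) / (X : ℝ)) / X) atTop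
      (𝓝 (∫ x in (0 : ℝ)..1, F x)) := by
  rw [Metric.tendsto_atTop]
  intro ε hε
  have huc := isCompact_Icc.uniformContinuousOn_of_continuous
    (hF.continuousOn (s := Set.Icc (0 : ℝ) 1))
  rw [Metric.uniformContinuousOn_iff] at huc
  obtain ⟨δ, hδ, H⟩ := huc (ε / 2) (by positivity)
  obtain ⟨K, hK⟩ := exists_nat_gt (1 / δ)
  refine ⟨K + 1, fun X hX => ?_⟩
  have hX0 : (0 : ℝ) < X := by exact_mod_cast (by omega : 0 < X)
  have hXδ : 1 / (X : ℝ) < δ := by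
    rw [div_lt_comm₀ hX0 hδ]
    exact hK.trans_le (by exact_mod_cast (by omega : K ≤ X))
  have hI : ∑ k ∈ Finset.range X, ∫ x in ((k : ℕ) / (X : ℝ))..((k + 1 : ℕ) / (X : ℝ)), F x
      = ∫ x in (0 : ℝ)..1, F x := by
    have := intervalIntegral.sum_integral_adjacent_intervals (μ := MeasureTheory.volume)
      (f := F) (a := fun k : ℕ => (k : ℝ) / X) (n := X)
      (fun k _ => hF.intervalIntegrable _ _)
    rw [this]
    simp [hX0.ne']
  rw [← hI, Real.dist_eq, ← Finset.sum_sub_distrib]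
  have hb : ∀ k ∈ Finset.range X, |F ((k + 1 : ℕ) / (X : ℝ)) / X -
      ∫ x in ((k : ℕ) / (X : ℝ))..((k + 1 : ℕ) / (X : ℝ)), F x| ≤ ε / 2 / X := by
    intro k hk
    have hkX : ((k : ℝ) + 1) ≤ X := by exact_mod_cast Finset.mem_range.mp hk
    have hw : ((k + 1 : ℕ) : ℝ) / X - (k : ℕ) / X = 1 / X := by push_cast; ring
    have e : F ((k + 1 : ℕ) / (X : ℝ)) / X
        = ∫ x in ((k : ℕ) / (X : ℝ))..((k + 1 : ℕ) / (X : ℝ)), F ((k + 1 : ℕ) / (X : ℝ)) := by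
      rw [intervalIntegral.integral_const, hw, smul_eq_mul]; ring
    rw [e, ← intervalIntegral.integral_sub (by simp) (hF.intervalIntegrable _ _)]
    have := intervalIntegral.norm_integral_le_of_norm_le_const (a := (k : ℕ) / (X : ℝ))
      (b := (k + 1 : ℕ) / (X : ℝ)) (C := ε / 2)
      (f := fun x => F ((k + 1 : ℕ) / (X : ℝ)) - F x) ?_
    · rw [Real.norm_eq_abs, hw, abs_of_pos (by positivity : 0 < 1 / (X : ℝ))] at this
      calc _ ≤ _ := this
        _ = _ := by ring
    · intro x hx
      rw [Set.uIoc_of_le (by gcongr; omega)] at hx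
      have h0 : (0 : ℝ) ≤ (k : ℝ) / X := by positivity
      have h1 : ((k + 1 : ℕ) : ℝ) / X ≤ 1 := by rw [div_le_one hX0]; push_cast; exact hkX
      refine (H _ ⟨by positivity, h1⟩ _ ⟨h0.trans hx.1.le, hx.2.trans h1⟩ ?_).le
      rw [Real.dist_eq, abs_lt]
      constructor <;> linarith [hx.1, hx.2]
  calc |∑ k ∈ Finset.range X, (F ((k + 1 : ℕ) / (X : ℝ)) / X -
      ∫ x in ((k : ℕ) / (X : ℝ))..((k + 1 : ℕ) / (X : ℝ)), F x)|
      ≤ ∑ k ∈ Finset.range X, ε / 2 / X :=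
        (Finset.abs_sum_le_sum_abs _ _).trans (Finset.sum_le_sum hb)
    _ = ε / 2 := by rw [Finset.sum_const, Finset.card_range, nsmul_eq_mul]; field_simp
    _ < ε := by linarith

/-- The inverse tangent integral `∫₀ˣ arctan w / w dw`. -/
noncomputable def arctanIntegral (x : ℝ) : ℝ := ∫ w in (0 : ℝ)..x, dslope Real.arctan 0 w

lemma continuous_dslope_arctan : Continuous (dslope Real.arctan 0) := by
  rw [← continuousOn_univ]
  exact (continuousOn_dslope Filter.univ_mem).2
    ⟨Real.continuous_arctan.continuousOn, Real.differentiableAt_arctan 0⟩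

lemma dslope_arctan_of_ne {x : ℝ} (hx : x ≠ 0) : dslope Real.arctan 0 x = Real.arctan x / x := by
  rw [dslope_of_ne _ hx, slope_def_field]; simp

lemma hasDerivAt_arctanIntegral (x : ℝ) :
    HasDerivAt arctanIntegral (dslope Real.arctan 0 x) x :=
  continuous_dslope_arctan.integral_hasStrictDerivAt 0 x |>.hasDerivAt

/-- Since arctan x + arctan (1/x) = π/2 for x > 0, the left side has derivative π/(2x); both sides
vanish at κ = 1. -/
lemma arctanIntegral_sub_inv {κ : ℝ} (hκ : 0 < κ) :
    arctanIntegral κ - arctanIntegral κ⁻¹ = Real.pi / 2 * Real.log κ := by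
  set f := fun x : ℝ => arctanIntegral x - arctanIntegral x⁻¹ - Real.pi / 2 * Real.log x with hf
  have hd : ∀ x ∈ Set.Ioi (0 : ℝ), HasDerivAt f 0 x := by
    intro x hx
    have hx0 : (0 : ℝ) < x := hx
    have h1 := (hasDerivAt_arctanIntegral x⁻¹).comp x (hasDerivAt_inv hx0.ne')
    have h2 := ((hasDerivAt_arctanIntegral x).sub h1).sub
      ((Real.hasDerivAt_log hx0.ne').const_mul (Real.pi / 2))
    refine h2.congr_deriv ?_
    rw [dslope_arctan_of_ne hx0.ne', dslope_arctan_of_ne (inv_pos.2 hx0).ne',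
      Real.arctan_inv_of_pos hx0]
    field_simp
    ring
  have hc := (convex_Ioi (0 : ℝ)).is_const_of_fderivWithin_eq_zero (𝕜 := ℝ) (f := f)
    (fun x hx => (hd x hx).differentiableAt.differentiableWithinAt)
    (fun x hx => by
      rw [fderivWithin_of_isOpen isOpen_Ioi hx]
      ext
      simp [(hd x hx).deriv]) (x := κ) (y := 1) hκ (by simp)
  simp only [hf, inv_one, sub_self, Real.log_one, mul_zero] at hc
  linarith

/-- These are Riemann sums of arctan(κ v^(p+1)) / v on [0, 1], and the substitution w = κ v^(p+1)
produces the factor 1/(p+1). Writing the integrand with `dslope` makes it continuous at 0. -/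
lemma tendsto_sum_arctan {κ : ℝ} (hκ : 0 < κ) (p : ℕ) :
    Tendsto (fun X : ℕ => ∑ k ∈ Finset.range X, 1 / ((k + 1 : ℕ) : ℝ) *
      Real.arctan (κ * ((k + 1 : ℕ) : ℝ) ^ (p + 1) / (X : ℝ) ^ (p + 1))) atTop
      (𝓝 (arctanIntegral κ / (p + 1))) := by
  set F := fun v : ℝ => dslope Real.arctan 0 (κ * v ^ (p + 1)) * (κ * v ^ p) with hF
  have hFc : Continuous F := by
    have := continuous_dslope_arctan
    fun_prop
  have hI : ∫ v in (0 : ℝ)..1, F v = arctanIntegral κ / (p + 1) := by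
    have hp : (p + 1 : ℝ) ≠ 0 := by positivity
    have := intervalIntegral.integral_comp_mul_deriv (a := 0) (b := 1)
      (f := fun v : ℝ => κ * v ^ (p + 1)) (f' := fun v => κ * ((p + 1 : ℕ) * v ^ p))
      (g := dslope Real.arctan 0)
      (fun x _ => by simpa using (hasDerivAt_pow (p + 1) x).const_mul κ)
      (by fun_prop) continuous_dslope_arctan
    simp only [Function.comp, one_pow, mul_one, zero_pow (Nat.succ_ne_zero p), mul_zero] at this
    rw [eq_div_iff hp, arctanIntegral, ← this, ← intervalIntegral.integral_mul_const]
    congr 1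
    ext v
    simp only [hF]; push_cast; ring
  rw [← hI]
  refine (tendsto_riemann_sum hFc).congr fun X => Finset.sum_congr rfl fun k hk => ?_
  have hX0 : (0 : ℝ) < X := by
    exact_mod_cast lt_of_le_of_lt (Nat.zero_le k) (Finset.mem_range.mp hk)
  have hk0 : (0 : ℝ) < ((k + 1 : ℕ) : ℝ) := by positivity
  simp only [hF]
  rw [dslope_arctan_of_ne (by positivity), div_pow, div_pow, mul_div_assoc]
  field_simp
  ring

/-! ### Tails of the double series and the exchange of summation. -/

lemma tendsto_of_mutual_le {T A R : ℕ → ℝ} {L : ℝ} (hA : Tendsto A atTop (𝓝 L))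
    (hR : Tendsto R atTop (𝓝 1)) (h1 : ∀ᶠ X in atTop, A X ≤ R X * T X)
    (h2 : ∀ᶠ X in atTop, T X ≤ R X * A X) : Tendsto T atTop (𝓝 L) := by
  have hl : Tendsto (fun X => A X / R X) atTop (𝓝 L) := by
    have h := hA.div hR one_ne_zero
    rw [div_one] at h
    exact h
  have hu : Tendsto (fun X => R X * A X) atTop (𝓝 L) := by simpa using hR.mul hA
  refine tendsto_of_tendsto_of_tendsto_of_le_of_le' hl hu ?_ h2
  filter_upwards [h1, hR.eventually (lt_mem_nhds (zero_lt_one' ℝ))] with X hX hX0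
  rw [div_le_iff₀ hX0, mul_comm]
  exact hX

lemma tendsto_one_add_inv_pow (q : ℕ) {Y : ℕ → ℕ} (hY : Tendsto Y atTop atTop) :
    Tendsto (fun X : ℕ => (1 + 1 / (Y X : ℝ)) ^ q) atTop (𝓝 1) := by
  have h : Tendsto (fun X : ℕ => (1 : ℝ) + 1 / (Y X : ℝ)) atTop (𝓝 (1 + 0)) :=
    (tendsto_one_div_atTop_nhds_zero_nat.comp hY).const_add 1
  simpa using h.pow q

/-- As a function of c the kernel is, up to a constant, again a kernel, with κ = 1 and p = 0. One
tail estimate therefore serves both variables. -/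
lemma lambertKernel_swap {κ : ℝ} (p : ℕ) (c x : ℝ) :
    lambertKernel κ p c x = κ * x ^ p * lambertKernel 1 0 (κ * x ^ (p + 1)) c := by
  unfold lambertKernel
  rw [pow_zero, mul_one, one_pow, one_mul, zero_add, mul_one, mul_one_div, mul_pow, ← pow_mul,
    mul_comm (p + 1) 2, add_comm]

lemma tendsto_sum_tail_right {κ : ℝ} (hκ : 0 < κ) (p : ℕ) :
    Tendsto (fun X : ℕ => ∑ n ∈ Finset.range X, ∑' k : ℕ,
      lambertKernel κ p ((X ^ (p + 1) + k + 1 : ℕ) : ℝ) ((n + 1 : ℕ) : ℝ)) atTop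
      (𝓝 (arctanIntegral κ / (p + 1))) := by
  have key : ∀ X : ℕ, 1 ≤ X → ∀ n : ℕ,
      1 / ((n + 1 : ℕ) : ℝ) *
        Real.arctan (κ * ((n + 1 : ℕ) : ℝ) ^ (p + 1) / (X : ℝ) ^ (p + 1)) ≤
      (1 + 1 / ((X ^ (p + 1) : ℕ) : ℝ)) ^ 2 * ∑' k : ℕ,
        lambertKernel κ p ((X ^ (p + 1) + k + 1 : ℕ) : ℝ) ((n + 1 : ℕ) : ℝ) ∧
      ∑' k : ℕ, lambertKernel κ p ((X ^ (p + 1) + k + 1 : ℕ) : ℝ) ((n + 1 : ℕ) : ℝ) ≤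
      (1 + 1 / ((X ^ (p + 1) : ℕ) : ℝ)) ^ 2 * (1 / ((n + 1 : ℕ) : ℝ) *
        Real.arctan (κ * ((n + 1 : ℕ) : ℝ) ^ (p + 1) / (X : ℝ) ^ (p + 1))) := by
    intro X hX n
    have hn : (0 : ℝ) < ((n + 1 : ℕ) : ℝ) := by positivity
    set u := κ * ((n + 1 : ℕ) : ℝ) ^ (p + 1) with hu
    have hu0 : 0 < u := by positivity
    -- The tail is in the variable m, hence the swapped kernel with p = 0 and the cutoff X^(p+1).
    obtain ⟨-, h1, h2⟩ := lambertKernel_tail one_pos 0 hu0 (X := X ^ (p + 1)) (Nat.one_le_pow _ _ hX)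
    simp only [zero_add, mul_one, one_mul, pow_one, Nat.cast_zero] at h1 h2
    have e1 : (fun k : ℕ => lambertKernel κ p ((X ^ (p + 1) + k + 1 : ℕ) : ℝ) ((n + 1 : ℕ) : ℝ)) =
        fun k => κ * ((n + 1 : ℕ) : ℝ) ^ p *
          lambertKernel 1 0 u ((X ^ (p + 1) + k + 1 : ℕ) : ℝ) := by
      funext k; rw [lambertKernel_swap]
    have hw : 0 < κ * ((n + 1 : ℕ) : ℝ) ^ p := by positivity
    have e2 : 1 / ((n + 1 : ℕ) : ℝ) * Real.arctan (u / (X : ℝ) ^ (p + 1)) =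
        κ * ((n + 1 : ℕ) : ℝ) ^ p * (Real.arctan (u / ((X ^ (p + 1) : ℕ) : ℝ)) / u) := by
      rw [Nat.cast_pow]
      generalize Real.arctan (u / (X : ℝ) ^ (p + 1)) = a
      rw [hu]; field_simp; ring
    rw [e1, tsum_mul_left, e2]
    constructor
    · calc _ ≤ _ := mul_le_mul_of_nonneg_left h1 hw.le
        _ = _ := by ring
    · calc _ ≤ _ := mul_le_mul_of_nonneg_left h2 hw.le
        _ = _ := by ring
  refine tendsto_of_mutual_le (tendsto_sum_arctan hκ p)
    (tendsto_one_add_inv_pow 2 (tendsto_pow_atTop (α := ℕ) (Nat.succ_ne_zero p))) ?_ ?_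
  · filter_upwards [eventually_ge_atTop 1] with X hX
    rw [Finset.mul_sum]
    exact Finset.sum_le_sum fun n _ => (key X hX n).1
  · filter_upwards [eventually_ge_atTop 1] with X hX
    rw [Finset.mul_sum]
    exact Finset.sum_le_sum fun n _ => (key X hX n).2

lemma tendsto_sum_tail_left {κ : ℝ} (hκ : 0 < κ) (p : ℕ) :
    Tendsto (fun X : ℕ => ∑ m ∈ Finset.range (X ^ (p + 1)), ∑' k : ℕ,
      lambertKernel κ p ((m + 1 : ℕ) : ℝ) ((X + k + 1 : ℕ) : ℝ)) atTop
      (𝓝 (arctanIntegral κ⁻¹ / (p + 1))) := by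
  have key : ∀ X : ℕ, 1 ≤ X → ∀ m : ℕ,
      1 / ((m + 1 : ℕ) : ℝ) *
        Real.arctan (κ⁻¹ * ((m + 1 : ℕ) : ℝ) ^ (0 + 1) / ((X ^ (p + 1) : ℕ) : ℝ) ^ (0 + 1)) /
          (p + 1) ≤
      (1 + 1 / (X : ℝ)) ^ (2 * (p + 1)) * ∑' k : ℕ,
        lambertKernel κ p ((m + 1 : ℕ) : ℝ) ((X + k + 1 : ℕ) : ℝ) ∧
      ∑' k : ℕ, lambertKernel κ p ((m + 1 : ℕ) : ℝ) ((X + k + 1 : ℕ) : ℝ) ≤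
      (1 + 1 / (X : ℝ)) ^ (2 * (p + 1)) * (1 / ((m + 1 : ℕ) : ℝ) *
        Real.arctan (κ⁻¹ * ((m + 1 : ℕ) : ℝ) ^ (0 + 1) / ((X ^ (p + 1) : ℕ) : ℝ) ^ (0 + 1)) /
          (p + 1)) := by
    intro X hX m
    have hm : (0 : ℝ) < ((m + 1 : ℕ) : ℝ) := by positivity
    obtain ⟨-, h1, h2⟩ := lambertKernel_tail hκ p hm hX
    have e : κ⁻¹ * ((m + 1 : ℕ) : ℝ) ^ (0 + 1) / ((X ^ (p + 1) : ℕ) : ℝ) ^ (0 + 1) =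
        ((m + 1 : ℕ) : ℝ) / (κ * (X : ℝ) ^ (p + 1)) := by
      rw [Nat.cast_pow]
      have hX0 : (0 : ℝ) < X := by exact_mod_cast hX
      field_simp
      ring
    have e2 : ∀ a : ℝ, 1 / ((m + 1 : ℕ) : ℝ) * a / (p + 1) = a / ((p + 1) * ((m + 1 : ℕ) : ℝ)) := by
      intro a; field_simp
    rw [e, e2]
    exact ⟨h1, h2⟩
  -- In m the Riemann sum is linear with X^(p+1) nodes, so exponent 0 is used; here the factor
  -- 1/(p+1) comes from the primitive of the kernel.
  have hA := ((tendsto_sum_arctan (inv_pos.2 hκ) 0).comp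
    (tendsto_pow_atTop (α := ℕ) (Nat.succ_ne_zero p))).div_const ((p : ℝ) + 1)
  simp only [Nat.cast_zero, zero_add, div_one] at hA
  refine tendsto_of_mutual_le hA (tendsto_one_add_inv_pow (2 * (p + 1)) tendsto_id) ?_ ?_
  · filter_upwards [eventually_ge_atTop 1] with X hX
    simp only [Function.comp, id]
    rw [Finset.mul_sum, Finset.sum_div]
    exact Finset.sum_le_sum fun n _ => (key X hX n).1
  · filter_upwards [eventually_ge_atTop 1] with X hX
    simp only [Function.comp, id]
    rw [Finset.sum_div, Finset.mul_sum]
    exact Finset.sum_le_sum fun n _ => (key X hX n).2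

lemma summable_lambertKernel_left {κ : ℝ} (hκ : 0 < κ) (p : ℕ) {c : ℝ} (hc : 0 < c) :
    Summable (fun k : ℕ => lambertKernel κ p c ((k + 1 : ℕ) : ℝ)) := by
  have h := (lambertKernel_tail hκ p hc le_rfl).1
  rw [← summable_nat_add_iff 1]
  refine h.congr fun k => ?_
  congr 2; ring

lemma summable_lambertKernel_right {κ : ℝ} (hκ : 0 < κ) (p : ℕ) {x : ℝ} (hx : 0 < x) :
    Summable (fun k : ℕ => lambertKernel κ p ((k + 1 : ℕ) : ℝ) x) := by
  have h := (summable_lambertKernel_left one_pos 0 (c := κ * x ^ (p + 1)) (by positivity)).mul_left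
    (κ * x ^ p)
  exact h.congr fun k => (lambertKernel_swap p _ _).symm

/-- The regularised difference between the two orders of summation of the kernel. -/
lemma tendsto_lambertKernel_exchange {κ : ℝ} (hκ : 0 < κ) (p : ℕ) :
    Tendsto (fun X : ℕ =>
      ∑ n ∈ Finset.range X, (∑' m : ℕ, lambertKernel κ p ((m + 1 : ℕ) : ℝ) ((n + 1 : ℕ) : ℝ)) -
      ∑ m ∈ Finset.range (X ^ (p + 1)),
        (∑' n : ℕ, lambertKernel κ p ((m + 1 : ℕ) : ℝ) ((n + 1 : ℕ) : ℝ))) atTop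
      (𝓝 (Real.pi / 2 * Real.log κ / (p + 1))) := by
  have h := (tendsto_sum_tail_right hκ p).sub (tendsto_sum_tail_left hκ p)
  rw [← sub_div, arctanIntegral_sub_inv hκ] at h
  refine h.congr fun X => ?_
  have e1 : ∀ n : ℕ, ∑' m : ℕ, lambertKernel κ p ((m + 1 : ℕ) : ℝ) ((n + 1 : ℕ) : ℝ) =
      ∑ m ∈ Finset.range (X ^ (p + 1)), lambertKernel κ p ((m + 1 : ℕ) : ℝ) ((n + 1 : ℕ) : ℝ) +
      ∑' k : ℕ, lambertKernel κ p ((X ^ (p + 1) + k + 1 : ℕ) : ℝ) ((n + 1 : ℕ) : ℝ) := by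
    intro n
    rw [← (summable_lambertKernel_right hκ p (by positivity)).sum_add_tsum_nat_add (X ^ (p + 1))]
    simp only [add_comm (X ^ (p + 1))]
  have e2 : ∀ m : ℕ, ∑' n : ℕ, lambertKernel κ p ((m + 1 : ℕ) : ℝ) ((n + 1 : ℕ) : ℝ) =
      ∑ n ∈ Finset.range X, lambertKernel κ p ((m + 1 : ℕ) : ℝ) ((n + 1 : ℕ) : ℝ) +
      ∑' k : ℕ, lambertKernel κ p ((m + 1 : ℕ) : ℝ) ((X + k + 1 : ℕ) : ℝ) := by
    intro m
    rw [← (summable_lambertKernel_left hκ p (by positivity)).sum_add_tsum_nat_add X]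
    simp only [add_comm X]
  -- Both orders contain the same finite rectangle, which cancels; only the two tails remain.
  simp_rw [e1, e2, Finset.sum_add_distrib]
  rw [Finset.sum_comm]
  ring

/-! ### Partial fractions and roots of unity. -/

/-- Partial fractions of `1 / (e^y - 1)` in the right half-plane. -/
lemma hasSum_inv_exp_sub_one {y : ℂ} (hy : 0 < y.re) :
    HasSum (fun m : ℕ => 2 * y / (y ^ 2 + (2 * (Real.pi : ℂ) * ((m + 1 : ℕ) : ℂ)) ^ 2))
      (1 / (Complex.exp y - 1) - 1 / y + 1 / 2) := by
  have hπ : (Real.pi : ℂ) ≠ 0 := by exact_mod_cast Real.pi_ne_zero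
  have hI := Complex.I_ne_zero
  have hI2 := Complex.I_sq
  have hy0 : y ≠ 0 := by rintro rfl; simp at hy
  set x := y / (2 * Real.pi * Complex.I) with hx
  have hyx : 2 * Real.pi * Complex.I * x = y := by rw [hx]; field_simp
  have hxZ : x ∈ Complex.integerComplement := by
    rintro ⟨n, hn⟩
    rw [← hyx, ← hn] at hy
    simp at hy
  have h := (summable_cotTerm hxZ).hasSum
  rw [show (∑' n, cotTerm x n) = _ from (cot_series_rep' hxZ).symm,
    Complex.cot_pi_eq_exp_ratio, hyx] at h
  have he : Complex.exp y - 1 ≠ 0 := by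
    intro h0
    have h1 : ‖Complex.exp y‖ = 1 := by rw [sub_eq_zero.mp h0]; simp
    rw [Complex.norm_exp, Real.exp_eq_one_iff] at h1
    exact hy.ne' h1
  have he' : 1 - Complex.exp y ≠ 0 := by rw [← neg_sub]; exact neg_ne_zero.2 he
  -- With y = 2πi x, π cot(πx) = i (1 + 2/(e^y - 1)); this factor normalises the coefficient of
  -- 1/(e^y - 1) to 1 and sends -1/x to -1/y.
  have h2 := h.mul_left (-Complex.I / (2 * Real.pi))
  convert! h2 using 1
  · funext m
    rw [cotTerm_identity hxZ]
    have hp : x + ((m : ℂ) + 1) ≠ 0 := by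
      simpa using Complex.integerComplement_add_ne_zero hxZ (m + 1)
    have hm : x - ((m : ℂ) + 1) ≠ 0 := by
      have := Complex.integerComplement_add_ne_zero hxZ (-(m + 1))
      push_cast at this
      rwa [← sub_eq_add_neg] at this
    have e : y ^ 2 + (2 * (Real.pi : ℂ) * ((m + 1 : ℕ) : ℂ)) ^ 2
        = -(2 * Real.pi) ^ 2 * ((x + ((m : ℂ) + 1)) * (x - ((m : ℂ) + 1))) := by
      rw [← hyx]; push_cast; ring_nf; rw [hI2]; ring
    rw [e]
    nth_rewrite 1 [← hyx]
    field_simp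
  · rw [← hyx] at hy0
    have hx0 : x ≠ 0 := by rintro h0; simp [h0] at hy0
    rw [hyx] at hy0
    have e : 1 / y = 1 / (2 * Real.pi * Complex.I * x) := by rw [hyx]
    rw [e]
    generalize Complex.exp y = E at *
    have : (E + 1) / (Complex.I * (1 - E)) = Complex.I * ((E + 1) / (E - 1)) := by
      rw [div_eq_iff (mul_ne_zero hI he')]
      have : Complex.I * ((E + 1) / (E - 1)) * (Complex.I * (1 - E)) =
        Complex.I ^ 2 * ((E + 1) * ((1 - E) / (E - 1))) := by ring
      rw [this, hI2, ← neg_sub E 1, neg_div, div_self he]; ring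
    rw [this]
    have hI3 : Complex.I ^ 3 = -Complex.I := by rw [pow_succ, hI2]; ring
    field_simp
    ring_nf
    simp only [hI3, hI2]
    ring

lemma sum_Icc_neg_eq_sum_range (M : ℕ) (f : ℤ → ℂ) :
    ∑ j ∈ Finset.Icc (-(M : ℤ)) M, f j = ∑ i ∈ Finset.range (2 * M + 1), f ((i : ℤ) - M) := by
  refine Finset.sum_nbij' (fun j => (j + M).toNat) (fun i => (i : ℤ) - M) ?_ ?_ ?_ ?_ ?_ <;>
    intro a ha <;> simp only [Finset.mem_Icc, Finset.mem_range] at ha ⊢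
  · omega
  · omega
  · omega
  · omega
  · congr 1; omega

/-- The root of unity `e^(iπj/N)`. -/
noncomputable def halfRoot (N : ℕ) (j : ℤ) : ℂ :=
  Complex.exp (Complex.I * (Real.pi : ℂ) * (j : ℂ) / (N : ℂ))

lemma halfRoot_ne_zero (N : ℕ) (j : ℤ) : halfRoot N j ≠ 0 := Complex.exp_ne_zero _

lemma halfRoot_pow_self {N : ℕ} (hN : N ≠ 0) (j : ℤ) : halfRoot N j ^ N = (-1) ^ j := by
  have hN' : (N : ℂ) ≠ 0 := by exact_mod_cast hN
  rw [halfRoot, ← Complex.exp_nat_mul, ← Complex.exp_pi_mul_I, ← Complex.exp_int_mul]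
  congr 1
  field_simp

lemma halfRoot_pow_two_mul {N : ℕ} (hN : N ≠ 0) (j : ℤ) : halfRoot N j ^ (2 * N) = 1 := by
  rw [mul_comm, pow_mul, halfRoot_pow_self hN, ← zpow_natCast, ← zpow_mul, mul_comm, zpow_mul]
  simp

lemma halfRoot_re_pos {M : ℕ} {j : ℤ} (hj : j ∈ Finset.Icc (-(M : ℤ)) M) :
    0 < (halfRoot (2 * M + 1) j).re := by
  have e : Complex.I * (Real.pi : ℂ) * (j : ℂ) / ((2 * M + 1 : ℕ) : ℂ) =
      ((Real.pi * j / (2 * M + 1 : ℕ) : ℝ) : ℂ) * Complex.I := by push_cast; ring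
  rw [halfRoot, e, Complex.exp_ofReal_mul_I_re]
  rw [Finset.mem_Icc] at hj
  have h1 : (-(M : ℝ)) ≤ j := by exact_mod_cast hj.1
  have h2 : (j : ℝ) ≤ M := by exact_mod_cast hj.2
  have hM : (0 : ℝ) < (2 * M + 1 : ℕ) := by positivity
  refine Real.cos_pos_of_mem_Ioo ⟨?_, ?_⟩
  · rw [lt_div_iff₀ hM]; push_cast; nlinarith [Real.pi_pos]
  · rw [div_lt_iff₀ hM]; push_cast; nlinarith [Real.pi_pos]

lemma sum_halfRoot_pow_of_dvd {M l : ℕ} (h : 2 * M + 1 ∣ l) :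
    ∑ j ∈ Finset.Icc (-(M : ℤ)) M, halfRoot (2 * M + 1) j ^ (2 * l) = ((2 * M + 1 : ℕ) : ℂ) := by
  obtain ⟨q, rfl⟩ := h
  rw [sum_Icc_neg_eq_sum_range, Finset.sum_congr rfl (g := fun _ => (1 : ℂ))]
  · simp
  · intro i _
    rw [← mul_assoc, pow_mul, halfRoot_pow_two_mul (by omega), one_pow]

/-- Up to a constant factor this is a full geometric sum of q = e^(2πil/N), an N-th root of unity
other than 1. -/
lemma sum_halfRoot_pow_of_not_dvd {M l : ℕ} (h : ¬ 2 * M + 1 ∣ l) :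
    ∑ j ∈ Finset.Icc (-(M : ℤ)) M, halfRoot (2 * M + 1) j ^ (2 * l) = 0 := by
  have hN : ((2 * M + 1 : ℕ) : ℂ) ≠ 0 := by exact_mod_cast (by omega : 2 * M + 1 ≠ 0)
  have hπ : (Real.pi : ℂ) ≠ 0 := by exact_mod_cast Real.pi_ne_zero
  set q := Complex.exp (l * (2 * Real.pi * Complex.I) / (2 * M + 1 : ℕ)) with hq
  have hqN : q ^ (2 * M + 1) = 1 := by
    rw [hq, ← Complex.exp_nat_mul, mul_div_cancel₀ _ hN]
    exact_mod_cast Complex.exp_nat_mul_two_pi_mul_I l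
  have hq1 : q ≠ 1 := by
    intro h1
    rw [hq, Complex.exp_eq_one_iff] at h1
    obtain ⟨n, hn⟩ := h1
    rw [div_eq_iff hN] at hn
    have h2 : (l : ℂ) = n * (2 * M + 1 : ℕ) := by
      have h3 : (2 * Real.pi * Complex.I : ℂ) ≠ 0 := by simp [Complex.I_ne_zero]
      apply mul_right_cancel₀ h3
      rw [hn]; ring
    have h4 : (l : ℤ) = n * (2 * M + 1 : ℕ) := by exact_mod_cast h2
    exact h (by exact_mod_cast (Dvd.intro_left n h4.symm))
  rw [sum_Icc_neg_eq_sum_range]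
  have e : ∀ i ∈ Finset.range (2 * M + 1), halfRoot (2 * M + 1) ((i : ℤ) - M) ^ (2 * l) =
      Complex.exp (-(M : ℂ) * (l * (2 * Real.pi * Complex.I)) / (2 * M + 1 : ℕ)) * q ^ i := by
    intro i _
    rw [hq, halfRoot, ← Complex.exp_nat_mul, ← Complex.exp_nat_mul, ← Complex.exp_add]
    congr 1
    push_cast
    ring
  rw [Finset.sum_congr rfl e, ← Finset.mul_sum]
  have := geom_sum_mul q (2 * M + 1)
  rw [hqN, sub_self] at this
  rw [(mul_eq_zero.mp this).resolve_right (sub_ne_zero.2 hq1), mul_zero]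

lemma sum_neg_one_zpow (M : ℕ) :
    ∑ j ∈ Finset.Icc (-(M : ℤ)) M, (-1 : ℂ) ^ j = (-1) ^ M := by
  rw [sum_Icc_neg_eq_sum_range]
  have e : ∀ i ∈ Finset.range (2 * M + 1), (-1 : ℂ) ^ ((i : ℤ) - M) = (-1) ^ i * (-1) ^ M := by
    intro i _
    rw [zpow_sub₀ (by norm_num), zpow_natCast, zpow_natCast]
    rcases neg_one_pow_eq_or ℂ M with h | h <;> simp [h, div_neg]
  rw [Finset.sum_congr rfl e, ← Finset.sum_mul, neg_one_geom_sum]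
  simp

/-- Since (-1)^j = z^N for z = e^(iπj/N), each summand is z^(2M), and N divides M only when M = 0.
This is why the poles 1/y contribute only for N = 1. -/
lemma sum_neg_one_zpow_div_halfRoot (M : ℕ) :
    ∑ j ∈ Finset.Icc (-(M : ℤ)) M, (-1 : ℂ) ^ j / halfRoot (2 * M + 1) j =
      if M = 0 then 1 else 0 := by
  have e : ∀ j ∈ Finset.Icc (-(M : ℤ)) M, (-1 : ℂ) ^ j / halfRoot (2 * M + 1) j =
      halfRoot (2 * M + 1) j ^ (2 * M) := by
    intro j _
    rw [← halfRoot_pow_self (N := 2 * M + 1) (by omega), pow_succ,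
      mul_div_cancel_right₀ _ (halfRoot_ne_zero _ _)]
  rw [Finset.sum_congr rfl e]
  split_ifs with h
  · subst h; simp
  · refine sum_halfRoot_pow_of_not_dvd fun hd => ?_
    have := Nat.le_of_dvd (by omega) hd
    omega

/-- Partial fractions over the rotated arguments. -/
lemma sum_halfRoot_partial_fraction (M : ℕ) {r w : ℝ} (hr : 0 < r) (hw : 0 < w) :
    ∑ j ∈ Finset.Icc (-(M : ℤ)) M, (-1 : ℂ) ^ j * (2 * (r * halfRoot (2 * M + 1) j) /
        ((r * halfRoot (2 * M + 1) j) ^ 2 + (w : ℂ) ^ 2)) =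
      (-1) ^ M * (2 * M + 1 : ℕ) * (((2 * r ^ (2 * M + 1) * w ^ (2 * M)) /
        (w ^ (2 * (2 * M + 1)) + r ^ (2 * (2 * M + 1))) : ℝ) : ℂ) := by
  set N := 2 * M + 1 with hN
  set D : ℂ := (w : ℂ) ^ (2 * N) + (r : ℂ) ^ (2 * N) with hD
  have hD0 : D ≠ 0 := by
    have : w ^ (2 * N) + r ^ (2 * N) ≠ 0 := by positivity
    rw [hD]; exact_mod_cast this
  have term : ∀ j ∈ Finset.Icc (-(M : ℤ)) M,
      (-1 : ℂ) ^ j * (2 * (r * halfRoot N j) / ((r * halfRoot N j) ^ 2 + (w : ℂ) ^ 2)) =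
      ∑ i ∈ Finset.range N, 2 * r / D * ((-1) ^ i * r ^ (2 * i) * w ^ (2 * (N - 1 - i))) *
        halfRoot N j ^ (2 * (M + 1 + i)) := by
    intro j _
    set z := halfRoot N j with hz
    -- As N is odd and z^(2N) = 1, the factor (rz)² + w² divides D = w^(2N) + r^(2N), a denominator
    -- independent of j.
    have hg := geom_sum₂_mul (-((r : ℂ) * z) ^ 2) ((w : ℂ) ^ 2) N
    have hodd : (-((r : ℂ) * z) ^ 2) ^ N = -(r : ℂ) ^ (2 * N) := by
      rw [Odd.neg_pow ⟨M, hN⟩, ← pow_mul, mul_pow, hz, halfRoot_pow_two_mul (by omega), mul_one]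
    rw [hodd, ← pow_mul] at hg
    set S := ∑ i ∈ Finset.range N, (-((r : ℂ) * z) ^ 2) ^ i * ((w : ℂ) ^ 2) ^ (N - 1 - i) with hS
    have hSD : S * ((r * z) ^ 2 + (w : ℂ) ^ 2) = D := by rw [hD]; linear_combination -hg
    have hne : (r * z) ^ 2 + (w : ℂ) ^ 2 ≠ 0 := by
      intro h0; rw [h0, mul_zero] at hSD; exact hD0 hSD.symm
    have hdiv : 2 * (r * z) / ((r * z) ^ 2 + (w : ℂ) ^ 2) = 2 * (r * z) * S / D := by
      rw [div_eq_div_iff hne hD0, ← hSD]; ring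
    rw [hdiv, ← halfRoot_pow_self (N := N) (by omega), ← hz, hS, Finset.mul_sum, Finset.sum_div,
      Finset.mul_sum]
    refine Finset.sum_congr rfl fun i _ => ?_
    have e1 : (-((r : ℂ) * z) ^ 2) ^ i = (-1) ^ i * r ^ (2 * i) * z ^ (2 * i) := by
      rw [neg_pow, ← pow_mul, mul_pow]; ring
    have e2 : z ^ (2 * (M + 1 + i)) = z ^ N * z * z ^ (2 * i) := by rw [hN]; ring
    rw [e1, e2, ← pow_mul]
    ring
  rw [Finset.sum_congr rfl term, Finset.sum_comm]
  simp_rw [← Finset.mul_sum]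
  -- For 0 ≤ i ≤ 2M the number M + 1 + i lies in [M + 1, 3M + 1], whose only multiple of 2M + 1 is
  -- attained at i = M.
  rw [Finset.sum_eq_single M]
  · rw [sum_halfRoot_pow_of_dvd ⟨1, by omega⟩, hD, show N - 1 - M = M by omega]
    rw [hN]
    push_cast
    ring
  · intro i hi hne
    rw [Finset.mem_range] at hi
    rw [sum_halfRoot_pow_of_not_dvd, mul_zero]
    rintro ⟨q, hq⟩
    have h1 : 0 < q := by
      rcases Nat.eq_zero_or_pos q with h | h
      · subst h; omega
      · exact h
    have h2 : q < 2 := by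
      by_contra hcon
      have : (2 * M + 1) * 2 ≤ (2 * M + 1) * q := Nat.mul_le_mul_left _ (by omega)
      omega
    have : q = 1 := by omega
    subst this
    omega
  · intro h; exact absurd (Finset.mem_range.2 (by omega)) h

/-! ### Convergence of the Lambert series and their expansion in the kernel. -/

/-- From e^t - 1 ≥ t^k / k! the terms are O(1/n²). The power k accommodates rotated arguments, which
grow only like n^(1/N). -/
lemma summable_inv_mul_exp_sub_one {y : ℕ → ℂ} {k : ℕ} (hk : k ≠ 0) {C : ℝ} (hC : 0 < C)
    (hy : ∀ n, 0 ≤ (y n).re) (hyk : ∀ n, C * ((n + 1 : ℕ) : ℝ) ≤ (y n).re ^ k) :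
    Summable (fun n : ℕ => 1 / (((n + 1 : ℕ) : ℂ) * (Complex.exp (y n) - 1))) := by
  have hs : Summable (fun n : ℕ => (k.factorial / C) * (1 / ((n + 1 : ℕ) : ℝ) ^ 2)) :=
    ((summable_nat_add_iff 1).2 (Real.summable_one_div_nat_pow.2 one_lt_two)).mul_left _
  refine Summable.of_norm_bounded hs fun n => ?_
  have hn : (0 : ℝ) < ((n + 1 : ℕ) : ℝ) := by positivity
  have hf : (0 : ℝ) < k.factorial := by exact_mod_cast k.factorial_pos
  have h1 : (y n).re ^ k / k.factorial ≤ Real.exp (y n).re - 1 := by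
    have h := Real.sum_le_exp_of_nonneg (hy n) (k + 1)
    rw [Finset.sum_range_succ] at h
    have h0 : (1 : ℝ) ≤ ∑ i ∈ Finset.range k, (y n).re ^ i / i.factorial := by
      have := Finset.single_le_sum (f := fun i : ℕ => (y n).re ^ i / (i.factorial : ℝ))
        (fun i _ => div_nonneg (pow_nonneg (hy n) i) (by positivity))
        (Finset.mem_range.2 (Nat.pos_of_ne_zero hk))
      simpa using this
    linarith
  have h2 : Real.exp (y n).re - 1 ≤ ‖Complex.exp (y n) - 1‖ := by
    have := norm_sub_norm_le (Complex.exp (y n)) 1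
    rwa [Complex.norm_exp, norm_one] at this
  have h3 : C * ((n + 1 : ℕ) : ℝ) / k.factorial ≤ ‖Complex.exp (y n) - 1‖ :=
    (div_le_div_of_nonneg_right (hyk n) hf.le).trans (h1.trans h2)
  rw [norm_div, norm_one, norm_mul, Complex.norm_natCast]
  calc 1 / (((n + 1 : ℕ) : ℝ) * ‖Complex.exp (y n) - 1‖)
      ≤ 1 / (((n + 1 : ℕ) : ℝ) * (C * ((n + 1 : ℕ) : ℝ) / k.factorial)) := by gcongr
    _ = _ := by field_simp

lemma HasSum.ofReal_of_complex {f : ℕ → ℝ} {s : ℝ} (h : HasSum (fun n => (f n : ℂ)) (s : ℂ)) :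
    HasSum f s := by exact_mod_cast h

lemma hasSum_inv_exp_sub_one_real {x : ℝ} (hx : 0 < x) :
    HasSum (fun m : ℕ => 2 * x / (x ^ 2 + (2 * Real.pi * ((m + 1 : ℕ) : ℝ)) ^ 2))
      (1 / (Real.exp x - 1) - 1 / x + 1 / 2) := by
  have h := hasSum_inv_exp_sub_one (y := (x : ℂ)) (by simpa using hx)
  refine HasSum.ofReal_of_complex ?_
  push_cast at h ⊢
  exact h

/-- The Lambert term as a row sum of the kernel. -/
lemma lambertTerm_eq {M : ℕ} {α κ : ℝ} (hκ : 0 < κ)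
    (hκα : 2 * Real.pi * κ = 2 ^ (2 * M + 1) * α) (n : ℕ) :
    lambertTerm (2 * M + 1) α (n + 1) =
      1 / (2 ^ (2 * M + 1) * α) * (1 / ((n + 1 : ℕ) : ℝ) ^ (2 * M + 2)) -
      1 / 2 * (1 / ((n + 1 : ℕ) : ℝ)) +
      1 / Real.pi * ∑' m : ℕ, lambertKernel κ (2 * M) ((m + 1 : ℕ) : ℝ) ((n + 1 : ℕ) : ℝ) := by
  have hπ := Real.pi_pos
  have hn : (0 : ℝ) < ((n + 1 : ℕ) : ℝ) := by positivity
  unfold lambertTerm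
  rw [← hκα]
  generalize ((n + 1 : ℕ) : ℝ) = t at *
  have hx : (2 * t) ^ (2 * M + 1) * α = 2 * Real.pi * κ * t ^ (2 * M + 1) := by
    rw [hκα, mul_pow]; ring
  rw [hx]
  set x := 2 * Real.pi * κ * t ^ (2 * M + 1) with hxd
  have hx0 : 0 < x := by positivity
  have h := ((hasSum_inv_exp_sub_one_real hx0).mul_left (1 / t)).tsum_eq
  have hk : ∀ m : ℕ, 1 / t * (2 * x / (x ^ 2 + (2 * Real.pi * ((m + 1 : ℕ) : ℝ)) ^ 2)) =
      1 / Real.pi * lambertKernel κ (2 * M) ((m + 1 : ℕ) : ℝ) t := by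
    intro m
    have hm : (0 : ℝ) < ((m + 1 : ℕ) : ℝ) := by positivity
    generalize ((m + 1 : ℕ) : ℝ) = s at *
    have e : x ^ 2 + (2 * Real.pi * s) ^ 2 =
        (2 * Real.pi) ^ 2 * (κ ^ 2 * t ^ (2 * (2 * M + 1)) + s ^ 2) := by
      rw [hxd]; ring
    have e2 : x = 2 * Real.pi * κ * (t ^ (2 * M) * t) := by rw [hxd, pow_succ]
    unfold lambertKernel
    rw [e, e2]
    have hd : κ ^ 2 * t ^ (2 * (2 * M + 1)) + s ^ 2 ≠ 0 := by positivity
    field_simp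
  simp_rw [hk] at h
  rw [tsum_mul_left] at h
  rw [h]
  have e3 : t ^ (2 * M + 2) = t * t ^ (2 * M + 1) := by ring
  rw [e3, one_div_mul_eq_div, one_div_mul_eq_div, hxd]
  have hy : Real.exp (2 * Real.pi * κ * t ^ (2 * M + 1)) - 1 ≠ 0 := by
    have := Real.one_lt_exp_iff.2 hx0
    rw [hxd] at this
    linarith
  field_simp
  ring

/-- The alternating combination of the rotated Lambert terms as a column sum of the kernel. -/
lemma sum_rotatedLambertTerm_eq {M : ℕ} {β κ : ℝ} (hβ : 0 < β) (hκ : 0 < κ)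
    (hκβ : 2 * κ * β ^ (2 * M + 1) = (2 * Real.pi) ^ (2 * M + 1)) (m : ℕ) :
    (-1 : ℂ) ^ M / ((2 * M + 1 : ℕ) : ℂ) * ∑ j ∈ Finset.Icc (-(M : ℤ)) M,
        (-1 : ℂ) ^ j * rotatedLambertTerm (2 * M + 1) β j (m + 1) =
      (((if M = 0 then 1 / (2 * β) else 0) * (1 / ((m + 1 : ℕ) : ℝ) ^ 2) -
      1 / (2 * ((2 * M + 1 : ℕ) : ℝ)) * (1 / ((m + 1 : ℕ) : ℝ)) +
      1 / Real.pi *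
        ∑' n : ℕ, lambertKernel κ (2 * M) ((m + 1 : ℕ) : ℝ) ((n + 1 : ℕ) : ℝ) : ℝ) : ℂ) := by
  have hπ := Real.pi_pos
  set N := 2 * M + 1 with hN
  have hN0 : (0 : ℝ) < (N : ℝ) := by rw [hN]; positivity
  have hm : (0 : ℝ) < ((m + 1 : ℕ) : ℝ) := by positivity
  have hm0 : (((m + 1 : ℕ) : ℝ) : ℂ) ≠ 0 := by exact_mod_cast hm.ne'
  unfold rotatedLambertTerm
  rw [← Complex.ofReal_natCast (m + 1)]
  set s := ((m + 1 : ℕ) : ℝ) with hs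
  set r : ℝ := (2 * s) ^ (1 / (N : ℝ)) * β with hr
  have hr0 : 0 < r := by positivity
  have hrN : r ^ N = 2 * s * β ^ N := by
    rw [hr, mul_pow, ← Real.rpow_natCast, ← Real.rpow_mul (by positivity),
      one_div_mul_cancel hN0.ne', Real.rpow_one]
  have hsgn : (-1 : ℂ) ^ M * (-1) ^ M = 1 := by
    rw [← mul_pow]; simp
  have hexp : ∀ j ∈ Finset.Icc (-(M : ℤ)) M, HasSum (fun n : ℕ =>
      (-1 : ℂ) ^ j * (2 * (r * halfRoot N j) /
        ((r * halfRoot N j) ^ 2 + ((2 * Real.pi * ((n + 1 : ℕ) : ℝ) : ℝ) : ℂ) ^ 2)))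
      ((-1 : ℂ) ^ j * (1 / (Complex.exp (r * halfRoot N j) - 1) - 1 / (r * halfRoot N j) + 1 / 2)) := by
    intro j hj
    have hre : 0 < ((r : ℂ) * halfRoot N j).re := by
      rw [Complex.re_ofReal_mul]
      exact mul_pos hr0 (halfRoot_re_pos hj)
    have := (hasSum_inv_exp_sub_one hre).mul_left ((-1 : ℂ) ^ j)
    push_cast at this ⊢
    exact this
  have hsum := (hasSum_sum hexp).mul_left ((-1 : ℂ) ^ M / (N : ℂ) * (1 / (s : ℂ)))
  have hterm : ∀ n : ℕ, (-1 : ℂ) ^ M / (N : ℂ) * (1 / (s : ℂ)) *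
      ∑ j ∈ Finset.Icc (-(M : ℤ)) M, (-1 : ℂ) ^ j * (2 * (r * halfRoot N j) /
        ((r * halfRoot N j) ^ 2 + ((2 * Real.pi * ((n + 1 : ℕ) : ℝ) : ℝ) : ℂ) ^ 2)) =
      ((1 / Real.pi * lambertKernel κ (2 * M) s ((n + 1 : ℕ) : ℝ) : ℝ) : ℂ) := by
    intro n
    have ht : (0 : ℝ) < ((n + 1 : ℕ) : ℝ) := by positivity
    generalize ((n + 1 : ℕ) : ℝ) = t at *
    rw [sum_halfRoot_partial_fraction M hr0 (by positivity : 0 < 2 * Real.pi * t)]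
    have hNc : (N : ℂ) ≠ 0 := by exact_mod_cast hN0.ne'
    have hreal : 1 / s * ((2 * r ^ (2 * M + 1) * (2 * Real.pi * t) ^ (2 * M)) /
        ((2 * Real.pi * t) ^ (2 * (2 * M + 1)) + r ^ (2 * (2 * M + 1)))) =
        1 / Real.pi * lambertKernel κ (2 * M) s t := by
      have hb : β ^ N ≠ 0 := by positivity
      -- Both r^N and (2π)^N are multiples of 2β^N, so the denominator becomes that of the kernel.
      have e1 : (2 * Real.pi * t) ^ (2 * (2 * M + 1)) + r ^ (2 * (2 * M + 1)) =
          4 * (β ^ N) ^ 2 * (κ ^ 2 * t ^ (2 * (2 * M + 1)) + s ^ 2) := by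
        rw [mul_comm 2 (2 * M + 1), pow_mul, pow_mul r, mul_pow, ← hκβ, ← hN, hrN, pow_mul t]
        ring
      have e2 : (2 * Real.pi * t) ^ (2 * M) = 2 * κ * β ^ N * t ^ (2 * M) / (2 * Real.pi) := by
        rw [eq_div_iff (by positivity), hκβ, mul_pow, hN]; ring
      rw [e1, e2, ← hN, hrN]
      unfold lambertKernel
      have hd : κ ^ 2 * t ^ (2 * (2 * M + 1)) + s ^ 2 ≠ 0 := by positivity
      field_simp
      ring
    rw [← hreal]
    rw [Complex.ofReal_mul (1 / s)]
    rw [← hN]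
    push_cast
    field_simp
    rw [pow_two, hsgn, one_mul]
  simp_rw [hterm] at hsum
  have hval := hsum.tsum_eq
  rw [← Complex.ofReal_tsum, tsum_mul_left] at hval
  rw [Complex.ofReal_add, hval]
  have hpole : ∑ j ∈ Finset.Icc (-(M : ℤ)) M, (-1 : ℂ) ^ j *
      (1 / (Complex.exp (r * halfRoot N j) - 1) - 1 / (r * halfRoot N j) + 1 / 2) =
      ∑ j ∈ Finset.Icc (-(M : ℤ)) M, (-1 : ℂ) ^ j * (1 / (Complex.exp (r * halfRoot N j) - 1)) -
      1 / (r : ℂ) * (if M = 0 then 1 else 0) + 1 / 2 * (-1) ^ M := by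
    rw [← sum_neg_one_zpow_div_halfRoot, ← sum_neg_one_zpow, Finset.mul_sum, Finset.mul_sum,
      ← Finset.sum_sub_distrib, ← Finset.sum_add_distrib]
    refine Finset.sum_congr rfl fun j _ => ?_
    rw [← hN]
    have := halfRoot_ne_zero N j
    have hrc : (r : ℂ) ≠ 0 := by exact_mod_cast hr0.ne'
    field_simp
  rw [hpole]
  have hfac : ∑ j ∈ Finset.Icc (-(M : ℤ)) M, (-1 : ℂ) ^ j *
      (1 / ((s : ℂ) * (Complex.exp (r * halfRoot N j) - 1))) =
      1 / (s : ℂ) * ∑ j ∈ Finset.Icc (-(M : ℤ)) M, (-1 : ℂ) ^ j *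
      (1 / (Complex.exp (r * halfRoot N j) - 1)) := by
    rw [Finset.mul_sum]
    refine Finset.sum_congr rfl fun j _ => ?_
    rw [one_div_mul_eq_div, mul_comm (s : ℂ), ← div_div, mul_div_assoc]
  change (-1 : ℂ) ^ M / (N : ℂ) * ∑ j ∈ Finset.Icc (-(M : ℤ)) M, (-1 : ℂ) ^ j *
      (1 / ((s : ℂ) * (Complex.exp (r * halfRoot N j) - 1))) = _
  rw [hfac]
  generalize ∑ j ∈ Finset.Icc (-(M : ℤ)) M, (-1 : ℂ) ^ j *
      (1 / (Complex.exp (r * halfRoot N j) - 1)) = S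
  have hNc : (N : ℂ) ≠ 0 := by exact_mod_cast hN0.ne'
  rcases eq_or_ne M 0 with h0 | h0
  · have hN1 : N = 1 := by omega
    have hr1 : r = 2 * s * β := by simpa [hN1] using hrN
    have hβc : (β : ℂ) ≠ 0 := by exact_mod_cast hβ.ne'
    simp only [h0, hN1, hr1, if_true]
    push_cast
    field_simp
    ring
  · simp only [h0, if_false]
    push_cast
    field_simp
    linear_combination (-(s : ℂ)) * hsgn

/-! ### The limit of the truncated identity. -/

lemma tendsto_sum_one_div_sub_log :
    Tendsto (fun X : ℕ => ∑ k ∈ Finset.range X, 1 / ((k + 1 : ℕ) : ℝ) - Real.log X) atTop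
      (𝓝 Real.eulerMascheroniConstant) := by
  refine Real.tendsto_harmonic_sub_log.congr fun X => ?_
  simp [harmonic]

lemma hasSum_one_div_succ_pow {k : ℕ} (hk : k ≠ 0) :
    HasSum (fun n : ℕ => 1 / ((n + 1 : ℕ) : ℝ) ^ (2 * k))
      ((-1 : ℝ) ^ (k + 1) * (2 : ℝ) ^ (2 * k - 1) * Real.pi ^ (2 * k) *
        bernoulli (2 * k) / (2 * k).factorial) := by
  have h := (hasSum_nat_add_iff' 1).2 (hasSum_zeta_nat hk)
  simpa [hk] using h

/-- The limit of the real partial sums. -/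
lemma tendsto_partial_sums {M : ℕ} {α β κ : ℝ} (hα : 0 < α) (hβ : 0 < β) (hκ : 0 < κ)
    (hκα : 2 * Real.pi * κ = 2 ^ (2 * M + 1) * α)
    (hαβ : α * β ^ (2 * M + 1) = Real.pi ^ (2 * M + 2)) :
    Tendsto (fun X : ℕ =>
      ∑ n ∈ Finset.range X, (1 / (2 ^ (2 * M + 1) * α) * (1 / ((n + 1 : ℕ) : ℝ) ^ (2 * M + 2)) -
        1 / 2 * (1 / ((n + 1 : ℕ) : ℝ)) +
        1 / Real.pi * ∑' m : ℕ, lambertKernel κ (2 * M) ((m + 1 : ℕ) : ℝ) ((n + 1 : ℕ) : ℝ)) -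
      ∑ m ∈ Finset.range (X ^ (2 * M + 1)),
        ((if M = 0 then 1 / (2 * β) else 0) * (1 / ((m + 1 : ℕ) : ℝ) ^ 2) -
        1 / (2 * ((2 * M + 1 : ℕ) : ℝ)) * (1 / ((m + 1 : ℕ) : ℝ)) +
        1 / Real.pi *
          ∑' n : ℕ, lambertKernel κ (2 * M) ((m + 1 : ℕ) : ℝ) ((n + 1 : ℕ) : ℝ))) atTop
      (𝓝 ((-1) ^ M * bernoulli (2 * M + 2) / (2 * M + 2).factorial * β ^ (2 * M + 1) -
        (if M = 0 then α / 12 else 0) -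
        M / (2 * M + 1) * Real.eulerMascheroniConstant +
        Real.log κ / (2 * (2 * M + 1)))) := by
  have hπ := Real.pi_pos
  have hpow : Tendsto (fun X : ℕ => X ^ (2 * M + 1)) atTop atTop :=
    tendsto_pow_atTop (α := ℕ) (Nat.succ_ne_zero _)
  have h1 := (hasSum_one_div_succ_pow (Nat.succ_ne_zero M)).tendsto_sum_nat.const_mul
    (1 / (2 ^ (2 * M + 1) * α))
  have h2 := ((hasSum_one_div_succ_pow one_ne_zero).tendsto_sum_nat.comp hpow).const_mul
    (if M = 0 then 1 / (2 * β) else 0)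
  have h3 := tendsto_sum_one_div_sub_log.const_mul (1 / 2 : ℝ)
  have h4 := (tendsto_sum_one_div_sub_log.comp hpow).const_mul (1 / (2 * ((2 * M + 1 : ℕ) : ℝ)))
  have h5 := (tendsto_lambertKernel_exchange hκ (2 * M)).const_mul (1 / Real.pi)
  have h := (((h1.sub h2).sub h3).add h4).add h5
  convert! h using 1
  · funext X
    simp only [Function.comp, Finset.sum_sub_distrib, Finset.sum_add_distrib, ← Finset.mul_sum]
    -- The cutoff X^N makes (1/2) log X cancel against (1/(2N)) log(X^N).
    have hlog : Real.log ((X ^ (2 * M + 1) : ℕ) : ℝ) = (2 * M + 1 : ℕ) * Real.log X := by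
      rw [Nat.cast_pow, Real.log_pow]
    rw [hlog, show 2 * Nat.succ M = 2 * M + 2 by omega]
    have hN : ((2 * M + 1 : ℕ) : ℝ) ≠ 0 := by positivity
    field_simp
    ring_nf
  · congr 1
    have e1 : 1 / (2 ^ (2 * M + 1) * α) * ((-1 : ℝ) ^ (Nat.succ M + 1) *
        (2 : ℝ) ^ (2 * Nat.succ M - 1) * Real.pi ^ (2 * Nat.succ M) *
        bernoulli (2 * Nat.succ M) / (2 * Nat.succ M).factorial) =
        (-1) ^ M * bernoulli (2 * M + 2) / (2 * M + 2).factorial * β ^ (2 * M + 1) := by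
      rw [show 2 * Nat.succ M = 2 * M + 2 by omega, show 2 * M + 2 - 1 = 2 * M + 1 by omega,
        ← hαβ, Nat.succ_eq_add_one, pow_succ (-1 : ℝ), pow_succ (-1 : ℝ)]
      field_simp
    have e2 : (if M = 0 then 1 / (2 * β) else 0) * ((-1 : ℝ) ^ (1 + 1) *
        (2 : ℝ) ^ (2 * 1 - 1) * Real.pi ^ (2 * 1) * bernoulli (2 * 1) / (2 * 1).factorial) =
        if M = 0 then α / 12 else 0 := by
      split_ifs with h0
      · subst h0
        have hab : α * β = Real.pi ^ 2 := by simpa using hαβ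
        have hb : (bernoulli 2 : ℚ) = 6⁻¹ := by
          rw [bernoulli_eq_bernoulli'_of_ne_one (by norm_num), bernoulli'_two]; norm_num
        rw [mul_one, hb, ← hab]
        norm_num [Nat.factorial]
        field_simp
        norm_num
      · simp
    rw [e1, e2]
    push_cast
    field_simp
    ring

/-! ### Assembly of the identity. -/

theorem mainTheorem4 (N : ℕ) (hN : Odd N) (α β : ℝ) (hα : 0 < α) (hβ : 0 < β)
    (hαβ : α * β ^ N = Real.pi ^ (N + 1)) :
    Summable (fun n : ℕ => lambertTerm N α (n + 1)) ∧
    (∀ j ∈ Finset.Icc (-(((N : ℤ) - 1) / 2)) (((N : ℤ) - 1) / 2),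
      Summable (fun n : ℕ => rotatedLambertTerm N β j (n + 1))) ∧
    ((∑' n : ℕ, lambertTerm N α (n + 1) : ℝ) : ℂ)
        - (-1 : ℂ) ^ ((N + 3) / 2) / (N : ℂ) *
          ∑ j ∈ Finset.Icc (-(((N : ℤ) - 1) / 2)) (((N : ℤ) - 1) / 2),
            (-1 : ℂ) ^ j * ∑' n : ℕ, rotatedLambertTerm N β j (n + 1)
      = ((((N : ℝ) - 1) * (Real.log 2 - Real.eulerMascheroniConstant) / (2 * (N : ℝ))
          + Real.log (α / β) / (2 * ((N : ℝ) + 1))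
          + (-1 : ℝ) ^ ((N + 3) / 2) *
            ∑ j ∈ Finset.range ((N + 1) / (2 * N) + 1),
              (-1 : ℝ) ^ j * (bernoulli (2 * j) : ℝ) * (bernoulli (N + 1 - 2 * N * j) : ℝ)
                / (((2 * j).factorial : ℝ) * ((N + 1 - 2 * N * j).factorial : ℝ))
                * α ^ (2 * (j : ℝ) / ((N : ℝ) + 1))
                * β ^ ((N : ℝ) - 2 * (N : ℝ) ^ 2 * (j : ℝ) / ((N : ℝ) + 1)) : ℝ) : ℂ) := by
  have hπ := Real.pi_pos
  obtain ⟨M, rfl⟩ := hN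
  have hM2 : (((2 * M + 1 : ℕ) : ℤ) - 1) / 2 = M := by omega
  rw [hM2]
  have hs1 : Summable (fun n : ℕ => lambertTerm (2 * M + 1) α (n + 1)) := by
    have h := summable_inv_mul_exp_sub_one (k := 1) one_ne_zero hα
      (y := fun n => (((2 * ((n + 1 : ℕ) : ℝ)) ^ (2 * M + 1) * α : ℝ) : ℂ))
      (fun n => by rw [Complex.ofReal_re]; positivity)
      (fun n => by
        rw [Complex.ofReal_re, pow_one, mul_comm]
        have h1 : (1 : ℝ) ≤ ((n + 1 : ℕ) : ℝ) := by exact_mod_cast Nat.succ_pos n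
        have h2 : 2 * ((n + 1 : ℕ) : ℝ) ≤ (2 * ((n + 1 : ℕ) : ℝ)) ^ (2 * M + 1) :=
          le_self_pow₀ (by linarith) (by omega)
        gcongr
        linarith)
    rw [← Complex.summable_ofReal]
    refine h.congr fun n => ?_
    unfold lambertTerm
    push_cast
    rfl
  have hs2 : ∀ j ∈ Finset.Icc (-(M : ℤ)) M,
      Summable (fun n : ℕ => rotatedLambertTerm (2 * M + 1) β j (n + 1)) := by
    intro j hj
    have hc := halfRoot_re_pos hj
    have hre : ∀ n : ℕ, ((((2 * ((n + 1 : ℕ) : ℝ)) ^ (1 / ((2 * M + 1 : ℕ) : ℝ)) * β : ℝ) : ℂ) *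
        halfRoot (2 * M + 1) j).re = (2 * ((n + 1 : ℕ) : ℝ)) ^ (1 / ((2 * M + 1 : ℕ) : ℝ)) *
        (β * (halfRoot (2 * M + 1) j).re) := by
      intro n
      rw [Complex.re_ofReal_mul, mul_assoc]
    refine summable_inv_mul_exp_sub_one (k := 2 * M + 1) (by omega)
      (C := (β * (halfRoot (2 * M + 1) j).re) ^ (2 * M + 1)) (by positivity)
      (y := fun n => (((2 * ((n + 1 : ℕ) : ℝ)) ^ (1 / ((2 * M + 1 : ℕ) : ℝ)) * β : ℝ) : ℂ) *
        halfRoot (2 * M + 1) j) (fun n => ?_) (fun n => ?_)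
    · rw [hre]; positivity
    · have hN0 : ((2 * M + 1 : ℕ) : ℝ) ≠ 0 := by positivity
      have h0 : (0 : ℝ) ≤ ((n + 1 : ℕ) : ℝ) := by positivity
      rw [hre, mul_pow _ (β * _), ← Real.rpow_natCast (_ ^ (1 / _)), ← Real.rpow_mul (by positivity),
        one_div_mul_cancel hN0, Real.rpow_one, mul_comm]
      gcongr
      linarith
  refine ⟨hs1, hs2, ?_⟩
  have hsign : (2 * M + 1 + 3) / 2 = M + 2 := by omega
  rw [hsign]
  have hsC : (-1 : ℂ) ^ (M + 2) = (-1) ^ M := by rw [pow_add]; norm_num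
  have hsR : (-1 : ℝ) ^ (M + 2) = (-1) ^ M := by rw [pow_add]; norm_num
  rw [hsC, hsR]
  set κ : ℝ := 2 ^ (2 * M + 1) * α / (2 * Real.pi) with hκd
  have hκ : 0 < κ := by positivity
  have hκα : 2 * Real.pi * κ = 2 ^ (2 * M + 1) * α := by rw [hκd]; field_simp
  -- The hypothesis on αβ^N says that the κ dictated by α is also the one needed on the β side.
  have hκβ : 2 * κ * β ^ (2 * M + 1) = (2 * Real.pi) ^ (2 * M + 1) := by
    rw [hκd]
    have : 2 * (2 ^ (2 * M + 1) * α / (2 * Real.pi)) * β ^ (2 * M + 1) =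
        2 ^ (2 * M + 1) * (α * β ^ (2 * M + 1)) / Real.pi := by field_simp
    rw [this, hαβ, mul_pow]
    field_simp
    ring
  have hpow : Tendsto (fun X : ℕ => X ^ (2 * M + 1)) atTop atTop :=
    tendsto_pow_atTop (α := ℕ) (Nat.succ_ne_zero _)
  have hreal := tendsto_partial_sums hα hβ hκ hκα hαβ
  -- Each series converges on its own, so the unequal cutoffs X and X^N still give the full left
  -- side.
  have hlhs : Tendsto (fun X : ℕ =>
      ((∑ n ∈ Finset.range X, lambertTerm (2 * M + 1) α (n + 1) : ℝ) : ℂ) -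
      (-1 : ℂ) ^ M / ((2 * M + 1 : ℕ) : ℂ) * ∑ j ∈ Finset.Icc (-(M : ℤ)) M, (-1 : ℂ) ^ j *
        ∑ m ∈ Finset.range (X ^ (2 * M + 1)), rotatedLambertTerm (2 * M + 1) β j (m + 1)) atTop
      (𝓝 (((∑' n : ℕ, lambertTerm (2 * M + 1) α (n + 1) : ℝ) : ℂ) -
        (-1 : ℂ) ^ M / ((2 * M + 1 : ℕ) : ℂ) * ∑ j ∈ Finset.Icc (-(M : ℤ)) M, (-1 : ℂ) ^ j *
        ∑' m : ℕ, rotatedLambertTerm (2 * M + 1) β j (m + 1))) := by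
    refine Tendsto.sub ?_ (Tendsto.const_mul _ (tendsto_finsetSum _ fun j hj => ?_))
    · exact (Complex.continuous_ofReal.tendsto _).comp hs1.hasSum.tendsto_sum_nat
    · exact ((hs2 j hj).hasSum.tendsto_sum_nat.comp hpow).const_mul _
  have hkey := tendsto_nhds_unique hlhs
    (((Complex.continuous_ofReal.tendsto _).comp hreal).congr fun X => ?_)
  · rw [hkey]
    congr 1
    have hlogκ : Real.log κ = 2 * M * Real.log 2 + Real.log α - Real.log Real.pi := by
      rw [hκd, Real.log_div (by positivity) (by positivity),
        Real.log_mul (by positivity) hα.ne', Real.log_mul two_ne_zero hπ.ne', Real.log_pow]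
      push_cast
      ring
    have hlogαβ : Real.log α + (2 * M + 1) * Real.log β = (2 * M + 2) * Real.log Real.pi := by
      have h := congrArg Real.log hαβ
      rw [Real.log_mul hα.ne' (by positivity), Real.log_pow, Real.log_pow] at h
      push_cast at h
      linear_combination h
    have hlog : Real.log (α / β) / (2 * (((2 * M + 1 : ℕ) : ℝ) + 1)) =
        (Real.log α - Real.log Real.pi) / (2 * (2 * M + 1)) := by
      rw [Real.log_div hα.ne' hβ.ne']
      push_cast
      rw [div_eq_div_iff (by positivity) (by positivity)]
      linear_combination (-2) * hlogαβ
    rw [hlog, hlogκ]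
    have hM1 : (2 * (M : ℝ) + 1) ≠ 0 := by positivity
    -- For M > 0 the floor is 0 and only j = 0 occurs. For M = 0 the extra term j = 1 is -B_2 B_0 α
    -- / 2! = -α/12, the contribution of ζ(2).
    have hbern : (-1 : ℝ) ^ M * bernoulli (2 * M + 2) / (2 * M + 2).factorial * β ^ (2 * M + 1) -
        (if M = 0 then α / 12 else 0) = (-1 : ℝ) ^ M *
        ∑ j ∈ Finset.range ((2 * M + 1 + 1) / (2 * (2 * M + 1)) + 1),
          (-1 : ℝ) ^ j * (bernoulli (2 * j) : ℝ) *
            (bernoulli (2 * M + 1 + 1 - 2 * (2 * M + 1) * j) : ℝ)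
            / (((2 * j).factorial : ℝ) * ((2 * M + 1 + 1 - 2 * (2 * M + 1) * j).factorial : ℝ))
            * α ^ (2 * (j : ℝ) / (((2 * M + 1 : ℕ) : ℝ) + 1))
            * β ^ (((2 * M + 1 : ℕ) : ℝ) -
              2 * ((2 * M + 1 : ℕ) : ℝ) ^ 2 * (j : ℝ) / (((2 * M + 1 : ℕ) : ℝ) + 1)) := by
      rcases Nat.eq_zero_or_pos M with h0 | h0
      · subst h0
        have hb : (bernoulli 2 : ℚ) = 6⁻¹ := by
          rw [bernoulli_eq_bernoulli'_of_ne_one (by norm_num), bernoulli'_two]; norm_num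
        norm_num [Finset.sum_range_succ, hb, Nat.factorial]
        ring
      · have hdiv : (2 * M + 1 + 1) / (2 * (2 * M + 1)) = 0 := Nat.div_eq_of_lt (by omega)
        rw [hdiv, zero_add, Finset.sum_range_one, if_neg h0.ne']
        simp only [Nat.cast_zero, mul_zero, zero_div, sub_zero, Real.rpow_zero, Real.rpow_natCast,
          pow_zero, bernoulli_zero, Nat.factorial_zero, Nat.sub_zero]
        push_cast
        ring
    rw [← hbern]
    push_cast
    field_simp
    ring
  · simp only [Function.comp]
    rw [Complex.ofReal_sub]
    congr 1
    · congr 1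
      exact Finset.sum_congr rfl fun n _ => (lambertTerm_eq hκ hκα n).symm
    · simp_rw [Finset.mul_sum (Finset.range _)]
      rw [Finset.sum_comm, Finset.mul_sum, Complex.ofReal_sum]
      exact Finset.sum_congr rfl fun m _ => (sum_rotatedLambertTerm_eq hβ hκ hκβ m).symm
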